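/- Let $(\mathcal X,\mathcal B)$ be a measurable space whose singletons are measurable, and let $r(x,dy)$ be a jump kernel on $\mathcal X$: for every $x$, $r(x,\cdot)$ is a measure with total mass $\hat r(x):=r(x,\mathcal X)\in(0,\infty)$ and $r(x,\{x\})=0$, and $x\mapsto r(x,B)$ is measurable for every $B\in\mathcal B$. Let $\nu$ be a probability measure on $\mathcal X$ and let $(X_s)_{s\ge 0}$ be the Markov jump process with initial law $\nu$ and transition kernel $r$: on entering $x$ it waits there an exponential time of parameter $\hat r(x)$ and then jumps according to $r(x,dy)/\hat r(x)$. Its explosion time is the supremum of its jump times, and from the explosion time on the process sits in a cemetery state. Assume that $(X_s)_{s\ge0}$ does not explode, i.e. its explosion time is $+\infty$, $\mathbb P_\nu$-almost surely. Let $g:[0,\infty)\times\mathcal X\times\mathcal X\to\mathbb R$ be bounded and measurable. For $\lambda>0$ let $X^\lambda$ be the time-inhomogeneous Markov jump process with initial law $\nu$ and transition kernel $r^\lambda_s(x,dy)=e^{\lambda g(s,x,y)}\,r(x,dy)$. That is, with $\hat r^\lambda_s(x):=r^\lambda_s(x,\mathcal X)$, if $X^\lambda$ enters the state $x$ at time $s$,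 then its next jump time $\tau$ satisfies $$P(\tau>u)=\exp\Big\{-\int_s^u \hat r^\lambda_v(x)\,dv\Big\},\qquad u\ge s,$$ and, given $\tau=u$, the new state has law $r^\lambda_u(x,dy)/\hat r^\lambda_u(x)$. Let $\tau^\lambda_\infty\in[0,\infty]$ be the explosion time of $X^\lambda$, i.e. the supremum of its jump times. Fix $t\ge 0$, put $|g|_r(s,x):=\int_{\mathcal X}|g(s,x,y)|\,r(x,dy)$, and suppose that $g$ satisfies condition $C[\nu,t]$: for some $\theta>0$, $$\mathbb E_\nu\Big[\exp\Big\{\theta\int_0^t |g|_r(s,X_s)\,ds\Big\}\Big]<\infty .$$ Then there is $\lambda_0>0$ such that, for every $\lambda\in(0,\lambda_0]$, the perturbed process $X^\lambda$ does not explode in $[0,t]$, $\mathbb P_\nu$-almost surely; that is, $\mathbb P_\nu(\tau^\lambda_\infty>t)=1$. -/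

import Mathlib

open MeasureTheory ProbabilityTheory
open scoped ENNReal NNReal

namespace MarkovJump

/-! ### Jump rate kernels -/

/-- A time-homogeneous jump kernel `r(x, dy)`: a measurable family of measures of finite and
positive total mass, with `r(x, {x}) = 0`. -/
class IsJumpKernel {X : Type*} [MeasurableSpace X] (r : Kernel X X) : Prop where
  mass_pos : ∀ x, 0 < r x Set.univ
  mass_lt_top : ∀ x, r x Set.univ < ∞
  no_self_jump : ∀ x, r x {x} = 0

/-- A time-dependent jump kernel `q_u(x, dy)`, written `q (u, x)`, whose total mass is, for each
state `x`, bounded above and bounded away from zero uniformly in the time `u`. -/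
class IsRateKernel {X : Type*} [MeasurableSpace X] (q : Kernel (ℝ × X) X) : Prop where
  bounds : ∀ x, ∃ c C : ℝ≥0, 0 < c ∧
    ∀ u, (c : ℝ≥0∞) ≤ q (u, x) Set.univ ∧ q (u, x) Set.univ ≤ (C : ℝ≥0∞)

/-- A bounded measurable function `g(s, x, y)`. Only its values at times `s ≥ 0` play a role below,
so this is the same as a bounded measurable function on `[0, ∞) × X × X`. -/
structure BoundedPerturbation (X : Type*) [MeasurableSpace X] where
  toFun : ℝ → X → X → ℝ
  measurable : Measurable fun p : ℝ × X × X => toFun p.1 p.2.1 p.2.2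
  bounded : ∃ B : ℝ, ∀ s x y, |toFun s x y| ≤ B

instance instIsSFiniteKernelOfIsJumpKernel {X : Type*} [MeasurableSpace X] (r : Kernel X X)
    [IsJumpKernel r] : IsSFiniteKernel r := by
  classical
  have hm : Measurable fun x => r x Set.univ := r.measurable_coe MeasurableSet.univ
  let A : ℕ → Set X := fun n => {x | ⌊(r x Set.univ).toReal⌋₊ = n}
  have hA : ∀ n, MeasurableSet (A n) := fun n =>
    (Nat.measurable_floor.comp hm.ennreal_toReal) (measurableSet_singleton n)
  refine ⟨fun n => Kernel.piecewise (hA n) r 0, fun n => ⟨(n + 1 : ℝ≥0), by simp, fun x => ?_⟩, ?_⟩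
  · rw [Kernel.piecewise_apply]
    split_ifs with hx
    · have hfl : ⌊(r x Set.univ).toReal⌋₊ = n := hx
      have h1 := (Nat.lt_floor_add_one (r x Set.univ).toReal).le
      rw [hfl] at h1
      rw [← ENNReal.ofReal_toReal (IsJumpKernel.mass_lt_top (r := r) x).ne]
      refine (ENNReal.ofReal_le_ofReal h1).trans (le_of_eq ?_)
      rw [ENNReal.ofReal, Real.toNNReal_add (by positivity) (by positivity)]
      simp
    · simp
  · ext x s hs
    rw [Kernel.sum_apply' _ _ hs, tsum_eq_single ⌊(r x Set.univ).toReal⌋₊]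
    · rw [Kernel.piecewise_apply, if_pos (show x ∈ A _ from rfl)]
    · intro n hn
      rw [Kernel.piecewise_apply, if_neg (show x ∉ A n from fun h => hn h.symm)]
      simp

/-- The jump kernel of the unperturbed process, seen as a (constant) time-dependent kernel. -/
noncomputable def unperturbedRate {X : Type*} [MeasurableSpace X] (r : Kernel X X) :
    Kernel (ℝ × X) X :=
  Kernel.prodMkLeft ℝ r

/-- The perturbed jump kernel `r^ε_s(x, dy) = e^{ε g(s, x, y)} r(x, dy)`. -/
noncomputable def perturbedRate {X : Type*} [MeasurableSpace X] (r : Kernel X X) [IsJumpKernel r]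
    (g : BoundedPerturbation X) (ε : ℝ) : Kernel (ℝ × X) X :=
  Kernel.withDensity (Kernel.prodMkLeft ℝ r)
    fun p y => ENNReal.ofReal (Real.exp (ε * g.toFun p.1 p.2 y))

theorem measurable_perturbation_density {X : Type*} [MeasurableSpace X]
    (g : BoundedPerturbation X) (ε : ℝ) :
    Measurable (Function.uncurry fun (p : ℝ × X) (y : X) =>
      ENNReal.ofReal (Real.exp (ε * g.toFun p.1 p.2 y))) := by
  have h : Measurable fun z : (ℝ × X) × X => g.toFun z.1.1 z.1.2 z.2 :=
    g.measurable.comp (by fun_prop : Measurable fun z : (ℝ × X) × X => (z.1.1, z.1.2, z.2))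
  exact (Real.measurable_exp.comp (h.const_mul ε)).ennreal_ofReal

instance instIsRateKernelUnperturbed {X : Type*} [MeasurableSpace X] (r : Kernel X X)
    [IsJumpKernel r] : IsRateKernel (unperturbedRate r) := by
  refine ⟨fun x => ⟨(r x Set.univ).toNNReal, (r x Set.univ).toNNReal, ?_, fun u => ?_⟩⟩
  · exact ENNReal.toNNReal_pos (IsJumpKernel.mass_pos x).ne' (IsJumpKernel.mass_lt_top x).ne
  · rw [ENNReal.coe_toNNReal (IsJumpKernel.mass_lt_top x).ne]
    simp [unperturbedRate, Kernel.prodMkLeft_apply]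

instance instIsRateKernelPerturbed {X : Type*} [MeasurableSpace X] (r : Kernel X X)
    [IsJumpKernel r] (g : BoundedPerturbation X) (ε : ℝ) : IsRateKernel (perturbedRate r g ε) := by
  obtain ⟨B, hB⟩ := g.bounded
  have hle : ∀ s x y, |ε * g.toFun s x y| ≤ |ε| * B := fun s x y => by
    rw [abs_mul]; exact mul_le_mul_of_nonneg_left (hB s x y) (abs_nonneg ε)
  have hne : ∀ x, r x Set.univ ≠ ∞ := fun x => (IsJumpKernel.mass_lt_top x).ne
  refine ⟨fun x => ⟨(Real.exp (-(|ε| * B))).toNNReal * (r x Set.univ).toNNReal,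
    (Real.exp (|ε| * B)).toNNReal * (r x Set.univ).toNNReal, ?_, fun u => ?_⟩⟩
  · exact mul_pos (Real.toNNReal_pos.2 (Real.exp_pos _))
      (ENNReal.toNNReal_pos (IsJumpKernel.mass_pos x).ne' (hne x))
  · rw [perturbedRate, Kernel.withDensity_apply' _ (measurable_perturbation_density g ε),
      ENNReal.coe_mul, ENNReal.coe_mul, ENNReal.coe_toNNReal (hne x), Measure.restrict_univ,
      Kernel.prodMkLeft_apply]
    have h1 : ∀ a : ℝ≥0∞, ∫⁻ _ : X, a ∂(r x) = a * r x Set.univ := fun a => lintegral_const a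
    constructor
    · refine (h1 _).symm.le.trans (lintegral_mono fun y => ENNReal.ofReal_le_ofReal ?_)
      exact Real.exp_le_exp.2 (abs_le.1 (hle u x y)).1
    · refine le_trans (lintegral_mono fun y => ENNReal.ofReal_le_ofReal ?_) (h1 _).le
      exact Real.exp_le_exp.2 (abs_le.1 (hle u x y)).2

/-! ### One step of the dynamics -/

/-- The holding time parameter at time `u` in the state `x`, i.e. the total jump rate. -/
noncomputable def totalRate {X : Type*} [MeasurableSpace X] (q : Kernel (ℝ × X) X)
    (u : ℝ) (x : X) : ℝ :=
  (q (u, x)).real Set.univ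

/-- The total jump rate at `x` accumulated between the times `s` and `u`. -/
noncomputable def cumulatedRate {X : Type*} [MeasurableSpace X] (q : Kernel (ℝ × X) X)
    (s u : ℝ) (x : X) : ℝ :=
  ∫ v in Set.Ioc s u, totalRate q v x

/-- The density in `u` of the law of the next jump time, when the state `x` is entered at time
`s`. -/
noncomputable def jumpTimeDensity {X : Type*} [MeasurableSpace X] (q : Kernel (ℝ × X) X)
    (p : ℝ × X) (u : ℝ) : ℝ≥0∞ :=
  (Set.Ioi p.1).indicator (fun v => ENNReal.ofReal
    (totalRate q v p.2 * Real.exp (-cumulatedRate q p.1 v p.2))) u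

/-- The law of the next jump time, when the state `x` is entered at time `s`. It is characterised
by its survival function, see `jumpTimeKernel_Ioi`. -/
noncomputable def jumpTimeKernel {X : Type*} [MeasurableSpace X] (q : Kernel (ℝ × X) X) :
    Kernel (ℝ × X) ℝ :=
  Kernel.withDensity (Kernel.const (ℝ × X) (volume : Measure ℝ)) (jumpTimeDensity q)

/-- The law `q_u(x, dy) / q_u(x, X)` of the new state, for a jump from `x` at time `u`. -/
noncomputable def jumpTargetKernel {X : Type*} [MeasurableSpace X] (q : Kernel (ℝ × X) X) :
    Kernel (ℝ × X) X where
  toFun p := (q p Set.univ)⁻¹ • q p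
  measurable' := by
    refine Measure.measurable_of_measurable_coe _ fun s hs => ?_
    simp only [Measure.smul_apply, smul_eq_mul]
    exact (q.measurable_coe MeasurableSet.univ).inv.mul (q.measurable_coe hs)

/-- The law of (next jump time, new state), given (time `s` at which the state `x` is entered,
`x`): first the jump time `u` is sampled, then the new state. -/
noncomputable def stepKernel {X : Type*} [MeasurableSpace X] (q : Kernel (ℝ × X) X) :
    Kernel (ℝ × X) (ℝ × X) :=
  jumpTimeKernel q ⊗ₖ
    (jumpTargetKernel q).comap (fun z : (ℝ × X) × ℝ => (z.2, z.1.2)) (by fun_prop)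

theorem measurable_totalRate {X : Type*} [MeasurableSpace X] (q : Kernel (ℝ × X) X) :
    Measurable fun p : ℝ × X => totalRate q p.1 p.2 :=
  (q.measurable_coe MeasurableSet.univ).ennreal_toReal

theorem measurable_cumulatedRate {X : Type*} [MeasurableSpace X] (q : Kernel (ℝ × X) X) :
    Measurable fun z : (ℝ × X) × ℝ => cumulatedRate q z.1.1 z.2 z.1.2 := by
  have hS : MeasurableSet {w : ((ℝ × X) × ℝ) × ℝ | w.1.1.1 < w.2 ∧ w.2 ≤ w.1.2} := by
    have a1 : Measurable fun w : ((ℝ × X) × ℝ) × ℝ => w.1.1.1 := by fun_prop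
    have a2 : Measurable fun w : ((ℝ × X) × ℝ) × ℝ => w.2 := by fun_prop
    have a3 : Measurable fun w : ((ℝ × X) × ℝ) × ℝ => w.1.2 := by fun_prop
    exact (measurableSet_lt a1 a2).inter (measurableSet_le a2 a3)
  have hf : Measurable fun w : ((ℝ × X) × ℝ) × ℝ => totalRate q w.2 w.1.1.2 :=
    (measurable_totalRate q).comp (by fun_prop : Measurable fun w : ((ℝ × X) × ℝ) × ℝ =>
      (w.2, w.1.1.2))
  have h := (hf.indicator hS).stronglyMeasurable.integral_prod_right' (ν := (volume : Measure ℝ))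
  convert h.measurable using 1
  funext z
  rw [cumulatedRate, ← integral_indicator measurableSet_Ioc]
  rfl

theorem measurable_jumpTimeDensity {X : Type*} [MeasurableSpace X] (q : Kernel (ℝ × X) X) :
    Measurable (Function.uncurry (jumpTimeDensity q)) := by
  have hS : MeasurableSet {z : (ℝ × X) × ℝ | z.1.1 < z.2} :=
    measurableSet_lt (by fun_prop) (by fun_prop)
  have h1 : Measurable fun z : (ℝ × X) × ℝ => totalRate q z.2 z.1.2 :=
    (measurable_totalRate q).comp (by fun_prop : Measurable fun z : (ℝ × X) × ℝ => (z.2, z.1.2))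
  exact ((h1.mul (Real.measurable_exp.comp
    (measurable_cumulatedRate q).neg)).ennreal_ofReal).indicator hS

theorem totalRate_bounds {X : Type*} [MeasurableSpace X] (q : Kernel (ℝ × X) X) [IsRateKernel q]
    (x : X) : ∃ c C : ℝ, 0 < c ∧ ∀ u, c ≤ totalRate q u x ∧ totalRate q u x ≤ C := by
  obtain ⟨c, C, hc, h⟩ := IsRateKernel.bounds (q := q) x
  refine ⟨c, C, by exact_mod_cast hc, fun u => ⟨?_, ?_⟩⟩
  · have := ENNReal.toReal_mono ((h u).2.trans_lt ENNReal.coe_lt_top).ne (h u).1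
    simpa [totalRate, Measure.real] using this
  · have := ENNReal.toReal_mono ENNReal.coe_ne_top (h u).2
    simpa [totalRate, Measure.real] using this

theorem lintegral_hazard_Ioc {h : ℝ → ℝ} (hm : Measurable h) {C : ℝ} (h0 : ∀ v, 0 ≤ h v)
    (hC : ∀ v, h v ≤ C) {s b : ℝ} (hsb : s ≤ b) :
    ∫⁻ u in Set.Ioc s b, ENNReal.ofReal (h u * Real.exp (-∫ v in Set.Ioc s u, h v)) =
      ENNReal.ofReal (1 - Real.exp (-∫ v in Set.Ioc s b, h v)) := by
  have hC0 : 0 ≤ C := (h0 0).trans (hC 0)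
  have hbd : ∀ v, ‖h v‖ ≤ C := fun v => by rw [Real.norm_of_nonneg (h0 v)]; exact hC v
  have hii : ∀ a b : ℝ, IntervalIntegrable h volume a b := fun a b =>
    (intervalIntegrable_const (c := C)).mono_fun hm.aestronglyMeasurable
      (Filter.Eventually.of_forall fun v => by
        rw [Real.norm_of_nonneg hC0]; exact hbd v)
  let H : ℝ → ℝ := fun u => ∫ v in s..u, h v
  have hHI : ∀ u, s ≤ u → ∫ v in Set.Ioc s u, h v = H u := fun u hu =>
    (intervalIntegral.integral_of_le hu).symm
  have hH0 : ∀ u, s ≤ u → 0 ≤ H u := fun u hu => by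
    rw [← hHI u hu]; exact integral_nonneg h0
  have hHd : ∀ u w, u ≤ w → 0 ≤ H w - H u ∧ H w - H u ≤ C * (w - u) := by
    intro u w huw
    have e : H w - H u = ∫ v in u..w, h v := intervalIntegral.integral_interval_sub_left (hii _ _)
      (hii _ _)
    rw [e]
    refine ⟨intervalIntegral.integral_nonneg huw fun v _ => h0 v, ?_⟩
    calc ∫ v in u..w, h v ≤ ∫ _ in u..w, C :=
          intervalIntegral.integral_mono huw (hii _ _) intervalIntegrable_const hC
      _ = C * (w - u) := by simp [mul_comm]
  let F : ℝ → ℝ := fun u => Real.exp (-H u)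
  have hFd : ∀ u w, s ≤ u → u ≤ w → |F u - F w| ≤ C * (w - u) := by
    intro u w hu huw
    obtain ⟨d0, d1⟩ := hHd u w huw
    have e : F w = F u * Real.exp (-(H w - H u)) := by
      simp only [F, ← Real.exp_add]; congr 1; ring
    have f0 : 0 ≤ F u := (Real.exp_pos _).le
    have f1 : F u ≤ 1 := Real.exp_le_one_iff.2 (by linarith [hH0 u hu])
    have g1 : 1 - (H w - H u) ≤ Real.exp (-(H w - H u)) := by
      linarith [Real.add_one_le_exp (-(H w - H u))]
    have g2 : Real.exp (-(H w - H u)) ≤ 1 := Real.exp_le_one_iff.2 (by linarith)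
    rw [e, abs_of_nonneg (by nlinarith)]
    nlinarith
  have hLip : LipschitzOnWith C.toNNReal F (Set.uIcc s b) := by
    refine LipschitzOnWith.of_dist_le_mul fun u hu w hw => ?_
    rw [Set.uIcc_of_le hsb] at hu hw
    rw [Real.coe_toNNReal _ hC0, Real.dist_eq, Real.dist_eq]
    rcases le_total u w with huw | hwu
    · rw [abs_sub_comm u w, abs_of_nonneg (sub_nonneg.2 huw)]
      exact hFd u w hu.1 huw
    · rw [abs_sub_comm (F u), abs_of_nonneg (sub_nonneg.2 hwu)]
      exact hFd w u hw.1 hwu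
  have hFTC := hLip.absolutelyContinuousOnInterval.integral_deriv_eq_sub
  have hloc : LocallyIntegrable h volume := fun x =>
    ⟨Set.Icc (x - 1) (x + 1), Icc_mem_nhds (by linarith) (by linarith),
      (intervalIntegrable_iff_integrableOn_Icc_of_le (by linarith)).1 (hii _ _)⟩
  have hder : ∀ᵐ u, deriv F u = -(h u * F u) := by
    filter_upwards [_root_.LocallyIntegrable.ae_hasDerivAt_integral hloc] with u hu
    have hd : HasDerivAt F (Real.exp (-H u) * -h u) u := (hu s).neg.exp
    rw [hd.deriv]
    simp only [F]; ring
  have hint : ∫ u in s..b, h u * F u = 1 - F b := by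
    have e1 : ∫ u in s..b, deriv F u = ∫ u in s..b, -(h u * F u) :=
      intervalIntegral.integral_congr_ae (hder.mono fun u hu _ => hu)
    rw [e1, intervalIntegral.integral_neg] at hFTC
    have e2 : F s = 1 := by simp [F, H]
    linarith
  have hFc : ContinuousOn F (Set.uIcc s b) := hLip.continuousOn
  have hI : IntervalIntegrable (fun u => h u * F u) volume s b := (hii s b).mul_continuousOn hFc
  rw [hHI b hsb]
  change _ = ENNReal.ofReal (1 - F b)
  rw [← hint, intervalIntegral.integral_of_le hsb,
    ofReal_integral_eq_lintegral_ofReal ((intervalIntegrable_iff_integrableOn_Ioc_of_le hsb).1 hI)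
      (Filter.Eventually.of_forall fun u => mul_nonneg (h0 u) (Real.exp_pos _).le)]
  refine setLIntegral_congr_fun measurableSet_Ioc fun u hu => ?_
  simp only [F]
  rw [hHI u hu.1.le]

theorem jumpTimeKernel_Ioc {X : Type*} [MeasurableSpace X] (q : Kernel (ℝ × X) X) [IsRateKernel q]
    (s : ℝ) (x : X) {b : ℝ} (hsb : s ≤ b) :
    jumpTimeKernel q (s, x) (Set.Ioc s b) =
      ENNReal.ofReal (1 - Real.exp (-cumulatedRate q s b x)) := by
  obtain ⟨c, C, hc, hq⟩ := totalRate_bounds q x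
  rw [jumpTimeKernel, Kernel.withDensity_apply' _ (measurable_jumpTimeDensity q),
    Kernel.const_apply]
  rw [cumulatedRate, ← lintegral_hazard_Ioc (h := fun v => totalRate q v x)
    ((measurable_totalRate q).comp (by fun_prop : Measurable fun v : ℝ => (v, x)))
    (fun v => hc.le.trans (hq v).1) (fun v => (hq v).2) hsb]
  refine setLIntegral_congr_fun measurableSet_Ioc fun u hu => ?_
  simp only [jumpTimeDensity]
  rw [Set.indicator_of_mem (Set.mem_Ioi.2 hu.1)]
  rfl

theorem jumpTimeKernel_Iic {X : Type*} [MeasurableSpace X] (q : Kernel (ℝ × X) X)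
    (s : ℝ) (x : X) : jumpTimeKernel q (s, x) (Set.Iic s) = 0 := by
  rw [jumpTimeKernel, Kernel.withDensity_apply' _ (measurable_jumpTimeDensity q),
    setLIntegral_congr_fun measurableSet_Iic (g := fun _ => 0) fun u hu => ?_]
  · simp
  · simp only [jumpTimeDensity]
    rw [Set.indicator_of_notMem (by simpa using hu)]

instance instIsMarkovKernelJumpTime {X : Type*} [MeasurableSpace X] (q : Kernel (ℝ × X) X)
    [IsRateKernel q] : IsMarkovKernel (jumpTimeKernel q) := by
  refine ⟨fun ⟨s, x⟩ => ⟨?_⟩⟩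
  obtain ⟨c, C, hc, hq⟩ := totalRate_bounds q x
  have hU : (⋃ n : ℕ, Set.Iic (s + n)) = Set.univ := by
    refine Set.eq_univ_of_forall fun u => Set.mem_iUnion.2 ?_
    obtain ⟨n, hn⟩ := exists_nat_ge (u - s)
    exact ⟨n, by simp only [Set.mem_Iic]; linarith⟩
  have hmono : Monotone fun n : ℕ => Set.Iic (s + n) := fun m n hmn =>
    Set.Iic_subset_Iic.2 (by have : (m : ℝ) ≤ n := by exact_mod_cast hmn
                             linarith)
  have h1 := tendsto_measure_iUnion_atTop (μ := jumpTimeKernel q (s, x)) hmono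
  rw [hU] at h1
  have h2 : ∀ n : ℕ, jumpTimeKernel q (s, x) (Set.Iic (s + n)) =
      ENNReal.ofReal (1 - Real.exp (-cumulatedRate q s (s + n) x)) := fun n => by
    have hle : s ≤ s + n := by simp
    rw [← jumpTimeKernel_Ioc q s x hle, ← Set.Iic_union_Ioc_eq_Iic hle, measure_union
      (Set.Iic_disjoint_Ioc le_rfl) measurableSet_Ioc, jumpTimeKernel_Iic, zero_add]
  have h3 : Filter.Tendsto (fun n : ℕ => cumulatedRate q s (s + n) x) Filter.atTop
      Filter.atTop := by
    refine Filter.tendsto_atTop_mono (f := fun n : ℕ => c * n) (fun n => ?_)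
      (tendsto_natCast_atTop_atTop.const_mul_atTop hc)
    have hfin : IsFiniteMeasure (volume.restrict (Set.Ioc s (s + n)) : Measure ℝ) := inferInstance
    have : ∫ _ in Set.Ioc s (s + (n : ℝ)), c ≤ cumulatedRate q s (s + n) x := by
      refine integral_mono (integrable_const c) ?_ fun v => (hq v).1
      refine Integrable.of_bound (C := C) ((measurable_totalRate q).comp
        (by fun_prop : Measurable fun v : ℝ => (v, x))).aestronglyMeasurable
        (Filter.Eventually.of_forall fun v => ?_)
      rw [Real.norm_of_nonneg (hc.le.trans (hq v).1)]
      exact (hq v).2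
    refine le_trans (le_of_eq ?_) this
    simp [mul_comm]
  have h4 : Filter.Tendsto (fun n : ℕ => ENNReal.ofReal
      (1 - Real.exp (-cumulatedRate q s (s + n) x))) Filter.atTop (nhds (ENNReal.ofReal (1 - 0))) :=
    ENNReal.tendsto_ofReal (((Real.tendsto_exp_neg_atTop_nhds_zero).comp h3).const_sub 1)
  have h5 := tendsto_nhds_unique h1 (h4.congr fun n => (h2 n).symm)
  simpa using h5

/-- The survival function of the jump time:
`P(jump time > u) = exp (- ∫_s^u q_v(x, X) dv)` for `u ≥ s`. -/
theorem jumpTimeKernel_Ioi {X : Type*} [MeasurableSpace X] (q : Kernel (ℝ × X) X) [IsRateKernel q]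
    (s : ℝ) (x : X) {u : ℝ} (hsu : s ≤ u) :
    jumpTimeKernel q (s, x) (Set.Ioi u) = ENNReal.ofReal (Real.exp (-cumulatedRate q s u x)) := by
  have h0 : 0 ≤ cumulatedRate q s u x := integral_nonneg fun v => ENNReal.toReal_nonneg
  have h1 : Real.exp (-cumulatedRate q s u x) ≤ 1 := Real.exp_le_one_iff.2 (by linarith)
  rw [← Set.compl_Iic, prob_compl_eq_one_sub measurableSet_Iic, ← Set.Iic_union_Ioc_eq_Iic hsu,
    measure_union (Set.Iic_disjoint_Ioc le_rfl) measurableSet_Ioc, jumpTimeKernel_Iic, zero_add,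
    jumpTimeKernel_Ioc q s x hsu, ← ENNReal.ofReal_one, ← ENNReal.ofReal_sub _ (by linarith)]
  congr 1
  ring

instance instIsMarkovKernelJumpTarget {X : Type*} [MeasurableSpace X] (q : Kernel (ℝ × X) X)
    [IsRateKernel q] : IsMarkovKernel (jumpTargetKernel q) := by
  refine ⟨fun ⟨u, x⟩ => ⟨?_⟩⟩
  obtain ⟨c, C, hc, hq⟩ := IsRateKernel.bounds (q := q) x
  change ((q (u, x) Set.univ)⁻¹ • q (u, x)) Set.univ = 1
  rw [Measure.smul_apply, smul_eq_mul]
  exact ENNReal.inv_mul_cancel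
    ((ENNReal.coe_pos.2 hc).trans_le (hq u).1).ne' ((hq u).2.trans_lt ENNReal.coe_lt_top).ne

instance instIsMarkovKernelStep {X : Type*} [MeasurableSpace X] (q : Kernel (ℝ × X) X)
    [IsRateKernel q] : IsMarkovKernel (stepKernel q) := by
  unfold stepKernel
  infer_instance

/-! ### The Markov jump process -/

/-- The law of the sequence `(T_n, Y_n)`, `n ≥ 0`, of jump times and visited states of the Markov
jump process with time-dependent jump kernel `q` and initial law `ν`: `T_0 = 0`, `Y_0 ∼ ν`, and,
given the past, `(T_{n+1}, Y_{n+1})` has law `stepKernel q (T_n, Y_n)`. -/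
noncomputable def jumpLaw {X : Type*} [MeasurableSpace X] (q : Kernel (ℝ × X) X) [IsRateKernel q]
    (ν : Measure X) : Measure (ℕ → ℝ × X) :=
  Kernel.trajMeasure (X := fun _ : ℕ => ℝ × X) ((Measure.dirac (0 : ℝ)).prod ν)
    fun n => (stepKernel q).comap
      (fun h : (i : Finset.Iic n) → ℝ × X => h ⟨n, Finset.mem_Iic.2 le_rfl⟩)
      (measurable_pi_apply _)

instance instIsProbabilityMeasureJumpLaw {X : Type*} [MeasurableSpace X] (q : Kernel (ℝ × X) X)
    [IsRateKernel q] (ν : Measure X) [IsProbabilityMeasure ν] :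
    IsProbabilityMeasure (jumpLaw q ν) := by
  unfold jumpLaw
  infer_instance

/-- The explosion time `τ_∞ = sup_n T_n ∈ [0, ∞]`, for a sequence `ω n = (T_n, Y_n)`. -/
noncomputable def explosionTime {X : Type*} (ω : ℕ → ℝ × X) : ℝ≥0∞ :=
  ⨆ n, ENNReal.ofReal (ω n).1

open Classical in
/-- The state at time `s ≥ 0` of the jump process with jump times and states `ω n = (T_n, Y_n)`: it
is `Y_n` for `T_n ≤ s < T_{n+1}`, and the cemetery state `none` from the explosion time on. -/
noncomputable def stateAt {X : Type*} (ω : ℕ → ℝ × X) (s : ℝ) : Option X :=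
  if h : ∃ n, s < (ω (n + 1)).1 then some (ω (Nat.find h)).2 else none

/-- The contraction `|α|_r(s, x) = ∫ |α(s, x, y)| r(x, dy)`, set to `0` at the cemetery state. -/
noncomputable def absContraction {X : Type*} [MeasurableSpace X] (r : Kernel X X)
    (α : ℝ → X → X → ℝ) (s : ℝ) : Option X → ℝ≥0∞
  | none => 0
  | some x => ∫⁻ y, ENNReal.ofReal |α s x y| ∂(r x)

/-- The exponential moments condition `C[ν, t]`: for some `θ > 0`,
`E_ν [exp (θ ∫_0^t |α|_r(s, X_s) ds)] < ∞`, where `X` is the (unperturbed) Markov jump process with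
jump kernel `r` and initial law `ν`. -/
def ExpMomentCondition {X : Type*} [MeasurableSpace X] (r : Kernel X X) [IsJumpKernel r]
    (ν : Measure X) (t : ℝ) (α : ℝ → X → X → ℝ) : Prop :=
  ∃ θ : ℝ, 0 < θ ∧
    ∫⁻ ω, EReal.exp ((ENNReal.ofReal θ *
      ∫⁻ s in Set.Icc 0 t, absContraction r α s (stateAt ω s) : ℝ≥0∞) : EReal)
      ∂(jumpLaw (unperturbedRate r) ν) < ∞

end MarkovJump

namespace MarkovJump

variable {X : Type*} [MeasurableSpace X]

/-! Write `c_ε` for the cumulated rate of the kernel perturbed by `ε g`, and `c_0` for that of `r`.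
Relative to `du r(x, dy)`, one step of the perturbed chain has density `e^{ε g - c_ε}`. This factors
as `e^{ε g - c_{2ε}/2} · (e^{-c_0} · e^{c_{2ε} + c_0 - 2 c_ε})^{1/2}`. The square of the first
factor is the step density for the parameter `2ε`, so it integrates to one. By Cauchy-Schwarz, a
perturbed step is thus at most the square root of an unperturbed step weighted by `e^{c_{2ε} + c_0 -
2 c_ε}` (`weightedStep_perturbedRate_le`).

The exponent is the second difference `∫∫ (e^{ε g} - 1)² r(x, dy) dv`. For small `ε` it is at most
`θ ∫ |g|_r dv` (`ofReal_cumulatedRate_le`). Along a path the weights multiply to the exponential of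
`θ` times the integral of `|g|_r(s, X_s)` up to `T_n` (`prod_expWeight_eq`). Iterating the one-step
bound gives `P^ε(T_n ≤ t)² ≤ E[exp(θ ∫_0^{T_n} |g|_r(s, X_s) ds) ; T_n ≤ t]`, with the unperturbed
process on the right (`jumpLaw_perturbedRate_le`). The integrand is dominated by the variable in
`C[ν, t]`, and it vanishes for large `n` because the unperturbed process does not explode. Hence the
right side tends to `0`. -/

/-! ### Integration against one step and along the chain -/

theorem lintegral_jumpTargetKernel (q : Kernel (ℝ × X) X) (p : ℝ × X) (f : X → ℝ≥0∞) :
    ∫⁻ y, f y ∂(jumpTargetKernel q p) = (q p Set.univ)⁻¹ * ∫⁻ y, f y ∂(q p) := by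
  change ∫⁻ y, f y ∂((q p Set.univ)⁻¹ • q p) = _
  rw [lintegral_smul_measure, smul_eq_mul]

/-- Integration against the law of (next jump time, new state). -/
theorem lintegral_stepKernel (q : Kernel (ℝ × X) X) [IsRateKernel q] [IsSFiniteKernel q]
    (s : ℝ) (x : X) {f : ℝ × X → ℝ≥0∞} (hf : Measurable f) :
    ∫⁻ z, f z ∂(stepKernel q (s, x)) =
      ∫⁻ u in Set.Ioi s, ENNReal.ofReal (Real.exp (-cumulatedRate q s u x)) *
        ∫⁻ y, f (u, y) ∂(q (u, x)) := by
  rw [stepKernel, Kernel.lintegral_compProd _ _ _ hf]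
  simp_rw [Kernel.comap_apply, lintegral_jumpTargetKernel]
  have hq : Measurable fun u : ℝ => q (u, x) Set.univ :=
    (q.measurable_coe MeasurableSet.univ).comp (by fun_prop : Measurable fun u : ℝ => (u, x))
  have hI : Measurable fun u : ℝ => ∫⁻ y, f (u, y) ∂(q (u, x)) := by
    have h := Measurable.lintegral_kernel_prod_right (κ := q)
      (f := fun (p : ℝ × X) (y : X) => f (p.1, y)) (by fun_prop)
    exact h.comp (by fun_prop : Measurable fun u : ℝ => (u, x))
  have hqI : Measurable fun u : ℝ => (q (u, x) Set.univ)⁻¹ * ∫⁻ y, f (u, y) ∂(q (u, x)) :=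
    hq.inv.mul hI
  rw [jumpTimeKernel, Kernel.lintegral_withDensity _ (measurable_jumpTimeDensity q) _ hqI, Kernel.const_apply, ← lintegral_indicator measurableSet_Ioi]
  refine lintegral_congr fun u => ?_
  by_cases hu : u ∈ Set.Ioi s
  · obtain ⟨c, C, hc, hb⟩ := IsRateKernel.bounds (q := q) x
    have h0 : q (u, x) Set.univ ≠ 0 := ((ENNReal.coe_pos.2 hc).trans_le (hb u).1).ne'
    have h1 : q (u, x) Set.univ ≠ ∞ := ((hb u).2.trans_lt ENNReal.coe_lt_top).ne
    rw [jumpTimeDensity, Set.indicator_of_mem hu, Set.indicator_of_mem hu, totalRate,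
      Measure.real, ENNReal.ofReal_mul ENNReal.toReal_nonneg, ENNReal.ofReal_toReal h1]
    -- The hazard rate in the jump time density cancels the normalisation of the target law.
    rw [mul_comm (q (u, x) Set.univ), mul_assoc, ← mul_assoc (q (u, x) Set.univ),
      ENNReal.mul_inv_cancel h0 h1, one_mul]
  · rw [jumpTimeDensity, Set.indicator_of_notMem hu, Set.indicator_of_notMem hu, zero_mul]

/-- The Markov property of the sequence of jump times and visited states. -/
theorem lintegral_jumpLaw_succ (q : Kernel (ℝ × X) X) [IsRateKernel q] (ν : Measure X)
    [IsProbabilityMeasure ν] (n : ℕ) {H : ((i : Finset.Iic n) → ℝ × X) → ℝ≥0∞} (hH : Measurable H)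
    {F : ℝ × X → ℝ × X → ℝ≥0∞} (hF : Measurable (Function.uncurry F)) :
    ∫⁻ ω, H (Preorder.frestrictLe n ω) * F (ω n) (ω (n + 1)) ∂(jumpLaw q ν) =
      ∫⁻ ω, H (Preorder.frestrictLe n ω) * ∫⁻ z, F (ω n) z ∂(stepKernel q (ω n))
        ∂(jumpLaw q ν) := by
  -- The law of the past up to `n`, composed with the step kernel, is the joint law of that past and
  -- the next point.
  have key := Kernel.map_frestrictLe_trajMeasure_compProd_eq_map_trajMeasure
    (X := fun _ : ℕ => ℝ × X) (μ₀ := (Measure.dirac (0 : ℝ)).prod ν)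
    (κ := fun n => (stepKernel q).comap
      (fun h : (i : Finset.Iic n) → ℝ × X => h ⟨n, Finset.mem_Iic.2 le_rfl⟩)
      (measurable_pi_apply _)) (a := n)
  have hn : Measurable fun h : (i : Finset.Iic n) → ℝ × X =>
      h ⟨n, Finset.mem_Iic.2 le_rfl⟩ := measurable_pi_apply _
  have hG : Measurable fun z : ((i : Finset.Iic n) → ℝ × X) × (ℝ × X) =>
      H z.1 * F (z.1 ⟨n, Finset.mem_Iic.2 le_rfl⟩) z.2 :=
    (hH.comp measurable_fst).mul
      (hF.comp ((hn.comp measurable_fst).prodMk measurable_snd))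
  have h1 := congrArg (fun μ => ∫⁻ z, H z.1 * F (z.1 ⟨n, Finset.mem_Iic.2 le_rfl⟩) z.2 ∂μ) key
  beta_reduce at h1
  rw [lintegral_map hG (by fun_prop), Measure.lintegral_compProd hG] at h1
  have hmeas : Measurable fun h : (i : Finset.Iic n) → ℝ × X =>
      ∫⁻ z, F (h ⟨n, Finset.mem_Iic.2 le_rfl⟩) z
        ∂(stepKernel q (h ⟨n, Finset.mem_Iic.2 le_rfl⟩)) :=
    (Measurable.lintegral_kernel_prod_right (κ := stepKernel q) hF).comp hn
  have h2 : ∀ h : (i : Finset.Iic n) → ℝ × X,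
      ∫⁻ z, H h * F (h ⟨n, Finset.mem_Iic.2 le_rfl⟩) z
        ∂(stepKernel q (h ⟨n, Finset.mem_Iic.2 le_rfl⟩)) =
      H h * ∫⁻ z, F (h ⟨n, Finset.mem_Iic.2 le_rfl⟩) z
        ∂(stepKernel q (h ⟨n, Finset.mem_Iic.2 le_rfl⟩)) := fun h =>
    lintegral_const_mul _ (hF.comp measurable_prodMk_left)
  simp only [Kernel.comap_apply] at h1
  simp_rw [h2] at h1
  refine h1.symm.trans ?_
  exact lintegral_map (hH.mul hmeas) (by fun_prop)

theorem lintegral_jumpLaw_zero (q : Kernel (ℝ × X) X) [IsRateKernel q] (ν : Measure X)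
    [IsProbabilityMeasure ν] {f : ℝ × X → ℝ≥0∞} (hf : Measurable f) :
    ∫⁻ ω, f (ω 0) ∂(jumpLaw q ν) = ∫⁻ x, f (0, x) ∂ν := by
  have h0 : Measurable fun h : (i : Finset.Iic 0) → ℝ × X => f (h ⟨0, Finset.mem_Iic.2 le_rfl⟩) :=
    hf.comp (measurable_pi_apply _)
  have h1 : ∫⁻ ω, f (ω 0) ∂(jumpLaw q ν) =
      ∫⁻ h : (i : Finset.Iic 0) → ℝ × X, f (h ⟨0, Finset.mem_Iic.2 le_rfl⟩)
        ∂((jumpLaw q ν).map (Preorder.frestrictLe 0)) := by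
    rw [lintegral_map h0 (by fun_prop)]
    rfl
  rw [h1, jumpLaw, Kernel.trajMeasure, Measure.map_comp _ _ (by fun_prop),
    Kernel.traj_map_frestrictLe, Kernel.partialTraj_self, Measure.id_comp,
    lintegral_map h0 (by fun_prop)]
  change ∫⁻ p, f p ∂((Measure.dirac (0 : ℝ)).prod ν) = _
  rw [lintegral_prod _ hf.aemeasurable, lintegral_dirac' _ (hf.lintegral_prod_right')]

/-- One step of the dynamics, weighted by `w`. -/
noncomputable def weightedStep (q : Kernel (ℝ × X) X) (w : ℝ × X → ℝ × X → ℝ≥0∞)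
    (f : ℝ × X → ℝ≥0∞) (p : ℝ × X) : ℝ≥0∞ :=
  ∫⁻ z, w p z * f z ∂(stepKernel q p)

theorem measurable_weightedStep (q : Kernel (ℝ × X) X) [IsRateKernel q]
    {w : ℝ × X → ℝ × X → ℝ≥0∞} (hw : Measurable (Function.uncurry w)) {f : ℝ × X → ℝ≥0∞}
    (hf : Measurable f) : Measurable (weightedStep q w f) :=
  Measurable.lintegral_kernel_prod_right (κ := stepKernel q) (hw.mul (hf.comp measurable_snd))

/-- A discrete Feynman-Kac formula: by the Markov property the last point is integrated out, turning
`f` into its weighted step, and one factor of the product disappears. -/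
theorem lintegral_jumpLaw_prod (q : Kernel (ℝ × X) X) [IsRateKernel q] (ν : Measure X)
    [IsProbabilityMeasure ν] {w : ℝ × X → ℝ × X → ℝ≥0∞} (hw : Measurable (Function.uncurry w))
    (n : ℕ) {f : ℝ × X → ℝ≥0∞} (hf : Measurable f) :
    ∫⁻ ω, (∏ k ∈ Finset.range n, w (ω k) (ω (k + 1))) * f (ω n) ∂(jumpLaw q ν) =
      ∫⁻ x, (weightedStep q w)^[n] f (0, x) ∂ν := by
  induction n generalizing f with
  | zero => simpa using lintegral_jumpLaw_zero q ν hf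
  | succ n ih =>
    rw [Function.iterate_succ_apply, ← ih (measurable_weightedStep q hw hf)]
    let H : ((i : Finset.Iic n) → ℝ × X) → ℝ≥0∞ := fun h =>
      ∏ k : Fin n, w (h ⟨k, Finset.mem_Iic.2 k.2.le⟩) (h ⟨k + 1, Finset.mem_Iic.2 k.2⟩)
    have hH : Measurable H := Finset.measurable_fun_prod _ fun k _ =>
      hw.comp (g := Function.uncurry w) (f := fun h : (i : Finset.Iic n) → ℝ × X =>
        (h ⟨k, Finset.mem_Iic.2 k.2.le⟩, h ⟨k + 1, Finset.mem_Iic.2 k.2⟩))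
        ((measurable_pi_apply _).prodMk (measurable_pi_apply _))
    have hHe : ∀ ω : ℕ → ℝ × X, H (Preorder.frestrictLe n ω) =
        ∏ k ∈ Finset.range n, w (ω k) (ω (k + 1)) := fun ω =>
      Fin.prod_univ_eq_prod_range (fun k => w (ω k) (ω (k + 1))) n
    have h := lintegral_jumpLaw_succ q ν n hH (F := fun p z => w p z * f z)
      (hw.mul (hf.comp measurable_snd))
    simp_rw [hHe] at h
    simp_rw [Finset.prod_range_succ, mul_assoc]
    exact h

theorem ae_jumpLaw_zero (q : Kernel (ℝ × X) X) [IsRateKernel q] (ν : Measure X)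
    [IsProbabilityMeasure ν] : ∀ᵐ ω ∂(jumpLaw q ν), (ω 0).1 = 0 := by
  have hS : MeasurableSet {p : ℝ × X | p.1 ≠ 0} :=
    (measurableSet_eq_fun measurable_fst measurable_const).compl
  have h := lintegral_jumpLaw_zero q ν (measurable_one.indicator hS)
  have h2 : ∀ x : X, ({p : ℝ × X | p.1 ≠ 0}.indicator 1 (0, x) : ℝ≥0∞) = 0 := by simp
  simp_rw [h2, lintegral_zero] at h
  have hm : Measurable fun ω : ℕ → ℝ × X => ({p : ℝ × X | p.1 ≠ 0}.indicator 1 (ω 0) : ℝ≥0∞) :=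
    (measurable_one.indicator hS).comp (measurable_pi_apply 0)
  filter_upwards [(lintegral_eq_zero_iff hm).1 h] with ω hω
  by_contra hne
  have : ω 0 ∈ {p : ℝ × X | p.1 ≠ 0} := hne
  simp [Set.indicator_of_mem this] at hω

theorem ae_jumpLaw_lt_succ (q : Kernel (ℝ × X) X) [IsRateKernel q] [IsSFiniteKernel q]
    (ν : Measure X) [IsProbabilityMeasure ν] :
    ∀ᵐ ω ∂(jumpLaw q ν), ∀ n, (ω n).1 < (ω (n + 1)).1 := by
  rw [ae_all_iff]
  intro n
  let S : Set ((ℝ × X) × (ℝ × X)) := {z | z.2.1 ≤ z.1.1}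
  have hS : MeasurableSet S := measurableSet_le (by fun_prop) (by fun_prop)
  have hF : Measurable (Function.uncurry fun p z => (S.indicator 1 (p, z) : ℝ≥0∞)) :=
    measurable_one.indicator hS
  have h := lintegral_jumpLaw_succ q ν n (H := fun _ => 1) measurable_const hF
  -- The step from `(s, x)` only charges jump times in `Set.Ioi s`.
  have h2 : ∀ p : ℝ × X, ∫⁻ z, (S.indicator 1 (p, z) : ℝ≥0∞) ∂(stepKernel q p) = 0 := by
    rintro ⟨s, x⟩
    rw [lintegral_stepKernel q s x (f := fun z => S.indicator 1 ((s, x), z))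
      (hF.comp measurable_prodMk_left),
      setLIntegral_congr_fun measurableSet_Ioi (g := fun _ => 0), lintegral_zero]
    intro u hu
    have : ∀ y : X, (S.indicator 1 ((s, x), (u, y)) : ℝ≥0∞) = 0 := fun y =>
      Set.indicator_of_notMem (by simpa [S] using hu) _
    simp [this]
  simp_rw [h2, mul_zero, lintegral_zero, one_mul] at h
  have hm : Measurable fun ω : ℕ → ℝ × X => (S.indicator 1 (ω n, ω (n + 1)) : ℝ≥0∞) :=
    hF.comp (f := fun ω : ℕ → ℝ × X => (ω n, ω (n + 1)))
      ((measurable_pi_apply n).prodMk (measurable_pi_apply (n + 1)))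
  filter_upwards [(lintegral_eq_zero_iff hm).1 h] with ω hω
  by_contra hne
  have : (ω n, ω (n + 1)) ∈ S := not_lt.1 hne
  simp [Set.indicator_of_mem this] at hω

/-! ### Total rates and their second difference in the perturbation parameter -/

instance isSFiniteKernel_unperturbedRate (r : Kernel X X) [IsJumpKernel r] :
    IsSFiniteKernel (unperturbedRate r) := by
  unfold unperturbedRate
  infer_instance

instance isSFiniteKernel_perturbedRate (r : Kernel X X) [IsJumpKernel r]
    (g : BoundedPerturbation X) (ε : ℝ) : IsSFiniteKernel (perturbedRate r g ε) :=
  Kernel.IsSFiniteKernel.withDensity _ fun _ _ => ENNReal.ofReal_ne_top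

theorem lintegral_perturbedRate (r : Kernel X X) [IsJumpKernel r] (g : BoundedPerturbation X)
    (ε u : ℝ) (x : X) {f : X → ℝ≥0∞} (hf : Measurable f) :
    ∫⁻ y, f y ∂(perturbedRate r g ε (u, x)) =
      ∫⁻ y, ENNReal.ofReal (Real.exp (ε * g.toFun u x y)) * f y ∂(r x) := by
  rw [perturbedRate, Kernel.lintegral_withDensity _ (measurable_perturbation_density g ε) _ hf,
    Kernel.prodMkLeft_apply]

theorem BoundedPerturbation.measurable_section (g : BoundedPerturbation X) (u : ℝ) (x : X) :
    Measurable (g.toFun u x) :=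
  g.measurable.comp (by fun_prop : Measurable fun y : X => (u, x, y))

theorem integrable_exp_perturbation (r : Kernel X X) [IsJumpKernel r] (g : BoundedPerturbation X)
    (ε u : ℝ) (x : X) : Integrable (fun y => Real.exp (ε * g.toFun u x y)) (r x) := by
  obtain ⟨B, hB⟩ := g.bounded
  have : IsFiniteMeasure (r x) := ⟨IsJumpKernel.mass_lt_top x⟩
  refine Integrable.of_bound (C := Real.exp (|ε| * B))
    (Real.measurable_exp.comp ((g.measurable_section u x).const_mul ε)).aestronglyMeasurable
    (Filter.Eventually.of_forall fun y => ?_)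
  rw [Real.norm_of_nonneg (Real.exp_pos _).le]
  refine Real.exp_le_exp.2 ((le_abs_self _).trans ?_)
  rw [abs_mul]
  exact mul_le_mul_of_nonneg_left (hB u x y) (abs_nonneg ε)

theorem totalRate_perturbedRate (r : Kernel X X) [IsJumpKernel r] (g : BoundedPerturbation X)
    (ε u : ℝ) (x : X) :
    totalRate (perturbedRate r g ε) u x = ∫ y, Real.exp (ε * g.toFun u x y) ∂(r x) := by
  rw [integral_eq_lintegral_of_nonneg_ae
    (Filter.Eventually.of_forall fun y => (Real.exp_pos _).le)
    (integrable_exp_perturbation r g ε u x).aestronglyMeasurable, totalRate, Measure.real,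
    ← lintegral_one, lintegral_perturbedRate r g ε u x measurable_const]
  simp

theorem totalRate_unperturbedRate (r : Kernel X X) (u : ℝ) (x : X) :
    totalRate (unperturbedRate r) u x = (r x).real Set.univ := by
  rw [totalRate, unperturbedRate, Kernel.prodMkLeft_apply]

theorem integrableOn_totalRate (q : Kernel (ℝ × X) X) [IsRateKernel q] (s u : ℝ) (x : X) :
    IntegrableOn (fun v => totalRate q v x) (Set.Ioc s u) := by
  obtain ⟨c, C, hc, hq⟩ := totalRate_bounds q x
  refine Integrable.of_bound (C := C) ((measurable_totalRate q).comp
    (by fun_prop : Measurable fun v : ℝ => (v, x))).aestronglyMeasurable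
    (Filter.Eventually.of_forall fun v => ?_)
  rw [Real.norm_of_nonneg (hc.le.trans (hq v).1)]
  exact (hq v).2

/-- Since `|e^z - 1| ≤ 2|z|` for `|z| ≤ 1`, the square is at most `4 ε² a²`. One factor `ε |a|` is
then bounded by `1`, leaving a bound linear in `|a|`, which is what `C[ν, t]` controls. -/
theorem exp_sub_one_sq_le {ε θ B a : ℝ} (hε : 0 < ε) (hεθ : 4 * ε ≤ θ) (ha : |a| ≤ B)
    (hεB : ε * B ≤ 1) : (Real.exp (ε * a) - 1) ^ 2 ≤ θ * |a| := by
  have h1 : |ε * a| = ε * |a| := by rw [abs_mul, abs_of_pos hε]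
  have h2 : ε * |a| ≤ 1 := (mul_le_mul_of_nonneg_left ha hε.le).trans hεB
  have h3 := Real.abs_exp_sub_one_le (x := ε * a) (h1 ▸ h2)
  rw [h1] at h3
  have h0 : 0 ≤ |a| := abs_nonneg a
  calc (Real.exp (ε * a) - 1) ^ 2 = |Real.exp (ε * a) - 1| ^ 2 := (sq_abs _).symm
    _ ≤ (2 * (ε * |a|)) ^ 2 := pow_le_pow_left₀ (abs_nonneg _) h3 2
    _ = 4 * ε * |a| * (ε * |a|) := by ring
    _ ≤ 4 * ε * |a| * 1 := mul_le_mul_of_nonneg_left h2 (by positivity)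
    _ = 4 * ε * |a| := mul_one _
    _ ≤ θ * |a| := mul_le_mul_of_nonneg_right hεθ h0

/-- The identity `e^{2z} + 1 - 2 e^z = (e^z - 1)²` integrated against `r x`. The first-order terms
in `ε` cancel and the result is nonnegative. -/
theorem totalRate_second_difference (r : Kernel X X) [IsJumpKernel r] (g : BoundedPerturbation X)
    (ε u : ℝ) (x : X) :
    Integrable (fun y => (Real.exp (ε * g.toFun u x y) - 1) ^ 2) (r x) ∧
    totalRate (perturbedRate r g (2 * ε)) u x + totalRate (unperturbedRate r) u x -
      2 * totalRate (perturbedRate r g ε) u x =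
      ∫ y, (Real.exp (ε * g.toFun u x y) - 1) ^ 2 ∂(r x) := by
  have : IsFiniteMeasure (r x) := ⟨IsJumpKernel.mass_lt_top x⟩
  have i1 := integrable_exp_perturbation r g ε u x
  have i2 := integrable_exp_perturbation r g (2 * ε) u x
  have e : ∀ y, (Real.exp (ε * g.toFun u x y) - 1) ^ 2 =
      Real.exp (2 * ε * g.toFun u x y) + 1 - 2 * Real.exp (ε * g.toFun u x y) := fun y => by
    rw [show 2 * ε * g.toFun u x y = ε * g.toFun u x y + ε * g.toFun u x y by ring, Real.exp_add]
    ring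
  simp_rw [e]
  refine ⟨(i2.add (integrable_const 1)).sub (i1.const_mul 2), ?_⟩
  have i3 : Integrable (fun y => Real.exp (2 * ε * g.toFun u x y) + 1) (r x) :=
    i2.add (integrable_const 1)
  rw [integral_sub i3 (i1.const_mul 2), integral_add i2 (integrable_const 1),
    integral_const_mul, totalRate_perturbedRate, totalRate_perturbedRate,
    totalRate_unperturbedRate]
  simp

theorem ofReal_cumulatedRate_le (r : Kernel X X) [IsJumpKernel r] (g : BoundedPerturbation X)
    {ε θ B : ℝ} (hB : ∀ s x y, |g.toFun s x y| ≤ B) (hε : 0 < ε) (hεθ : 4 * ε ≤ θ)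
    (hεB : ε * B ≤ 1) (s u : ℝ) (x : X) :
    ENNReal.ofReal (cumulatedRate (perturbedRate r g (2 * ε)) s u x +
      cumulatedRate (unperturbedRate r) s u x - 2 * cumulatedRate (perturbedRate r g ε) s u x) ≤
    ENNReal.ofReal θ * ∫⁻ v in Set.Ioc s u, absContraction r g.toFun v (some x) := by
  have i0 := integrableOn_totalRate (unperturbedRate r) s u x
  have i1 := integrableOn_totalRate (perturbedRate r g ε) s u x
  have i2 := integrableOn_totalRate (perturbedRate r g (2 * ε)) s u x
  have i3 : IntegrableOn (fun v => totalRate (perturbedRate r g (2 * ε)) v x +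
      totalRate (unperturbedRate r) v x) (Set.Ioc s u) := i2.add i0
  have i4 : IntegrableOn (fun v => totalRate (perturbedRate r g (2 * ε)) v x +
      totalRate (unperturbedRate r) v x - 2 * totalRate (perturbedRate r g ε) v x)
      (Set.Ioc s u) := i3.sub (i1.const_mul 2)
  have hθ : 0 ≤ θ := by linarith
  unfold cumulatedRate
  rw [← integral_add i2 i0, ← integral_const_mul, ← integral_sub i3 (i1.const_mul 2)]
  rw [ofReal_integral_eq_lintegral_ofReal i4 (Filter.Eventually.of_forall fun v => ?_),
    ← lintegral_const_mul' _ _ ENNReal.ofReal_ne_top]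
  · refine lintegral_mono fun v => ?_
    obtain ⟨hi, he⟩ := totalRate_second_difference r g ε v x
    rw [he, ofReal_integral_eq_lintegral_ofReal hi (Filter.Eventually.of_forall fun y =>
      sq_nonneg _), absContraction, ← lintegral_const_mul' _ _ ENNReal.ofReal_ne_top]
    refine lintegral_mono fun y => ?_
    rw [← ENNReal.ofReal_mul hθ]
    exact ENNReal.ofReal_le_ofReal (exp_sub_one_sq_le hε hεθ (hB v x y) hεB)
  · change 0 ≤ totalRate (perturbedRate r g (2 * ε)) v x +
      totalRate (unperturbedRate r) v x - 2 * totalRate (perturbedRate r g ε) v x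
    rw [(totalRate_second_difference r g ε v x).2]
    exact integral_nonneg fun y => sq_nonneg _

/-! ### Exponential weights -/

/-- The exponential weight collected between the jump at `p = (s, x)` and the next jump. -/
noncomputable def expWeight (r : Kernel X X) (α : ℝ → X → X → ℝ) (θ : ℝ) (p z : ℝ × X) : ℝ≥0∞ :=
  EReal.exp ((ENNReal.ofReal θ *
    ∫⁻ v in Set.Ioc p.1 z.1, absContraction r α v (some p.2) : ℝ≥0∞) : EReal)

theorem measurable_absContraction (r : Kernel X X) [IsJumpKernel r] (g : BoundedPerturbation X) :
    Measurable fun p : ℝ × X => absContraction r g.toFun p.1 (some p.2) := by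
  have h : Measurable (Function.uncurry fun (p : ℝ × X) (y : X) =>
      ENNReal.ofReal |g.toFun p.1 p.2 y|) :=
    (continuous_abs.measurable.comp (g.measurable.comp
      (by fun_prop : Measurable fun z : (ℝ × X) × X => (z.1.1, z.1.2, z.2)))).ennreal_ofReal
  exact Measurable.lintegral_kernel_prod_right (κ := Kernel.prodMkLeft ℝ r) h

theorem measurable_expWeight (r : Kernel X X) [IsJumpKernel r] (g : BoundedPerturbation X)
    (θ : ℝ) : Measurable (Function.uncurry (expWeight r g.toFun θ)) := by
  have hS : MeasurableSet {w : ((ℝ × X) × (ℝ × X)) × ℝ | w.1.1.1 < w.2 ∧ w.2 ≤ w.1.2.1} := by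
    have a1 : Measurable fun w : ((ℝ × X) × (ℝ × X)) × ℝ => w.1.1.1 := by fun_prop
    have a2 : Measurable fun w : ((ℝ × X) × (ℝ × X)) × ℝ => w.2 := by fun_prop
    have a3 : Measurable fun w : ((ℝ × X) × (ℝ × X)) × ℝ => w.1.2.1 := by fun_prop
    exact (measurableSet_lt a1 a2).inter (measurableSet_le a2 a3)
  have hf : Measurable fun w : ((ℝ × X) × (ℝ × X)) × ℝ =>
      absContraction r g.toFun w.2 (some w.1.1.2) :=
    (measurable_absContraction r g).comp
      (by fun_prop : Measurable fun w : ((ℝ × X) × (ℝ × X)) × ℝ => (w.2, w.1.1.2))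
  have h := (hf.indicator hS).lintegral_prod_right' (ν := (volume : Measure ℝ))
  have h2 : Measurable fun w : (ℝ × X) × (ℝ × X) =>
      ∫⁻ v in Set.Ioc w.1.1 w.2.1, absContraction r g.toFun v (some w.1.2) := by
    convert! h using 1
    funext w
    rw [← lintegral_indicator measurableSet_Ioc]
    rfl
  exact EReal.measurable_exp.comp (measurable_coe_ennreal_ereal.comp (h2.const_mul _))

theorem ofReal_exp_le_expWeight (r : Kernel X X) [IsJumpKernel r] (g : BoundedPerturbation X)
    {ε θ B : ℝ} (hB : ∀ s x y, |g.toFun s x y| ≤ B) (hε : 0 < ε) (hεθ : 4 * ε ≤ θ)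
    (hεB : ε * B ≤ 1) (s u : ℝ) (x y : X) :
    ENNReal.ofReal (Real.exp (cumulatedRate (perturbedRate r g (2 * ε)) s u x +
      cumulatedRate (unperturbedRate r) s u x - 2 * cumulatedRate (perturbedRate r g ε) s u x)) ≤
    expWeight r g.toFun θ (s, x) (u, y) := by
  rw [← EReal.exp_coe, expWeight]
  refine EReal.exp_monotone (le_trans ?_ (EReal.coe_ennreal_le_coe_ennreal_iff.2
    (ofReal_cumulatedRate_le r g hB hε hεθ hεB s u x)))
  -- `ENNReal.ofReal` truncates at `0`, which can only increase the exponent.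
  rw [EReal.coe_ennreal_ofReal]
  exact_mod_cast le_max_left _ _

/-! ### Cauchy-Schwarz comparison of the two dynamics -/

theorem lintegral_mul_rpow_half_le {α : Type*} [MeasurableSpace α] (μ : Measure α)
    {f g : α → ℝ≥0∞} (hf : Measurable f) (hg : Measurable g) :
    ∫⁻ a, f a * g a ^ (1 / 2 : ℝ) ∂μ ≤
      (∫⁻ a, f a ^ (2 : ℝ) ∂μ) ^ (1 / 2 : ℝ) * (∫⁻ a, g a ∂μ) ^ (1 / 2 : ℝ) := by
  have h := ENNReal.lintegral_mul_le_Lp_mul_Lq μ Real.HolderConjugate.two_two hf.aemeasurable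
    (hg.pow_const (1 / 2 : ℝ)).aemeasurable
  have e : ∀ a, (g a ^ (1 / 2 : ℝ)) ^ (2 : ℝ) = g a := fun a => by
    rw [← ENNReal.rpow_mul]; norm_num
  simpa only [e, Pi.mul_apply] using h

/-- A one-step Cauchy-Schwarz bound: the perturbed dynamics is controlled by the square root of
the unperturbed dynamics with exponential weights. -/
theorem weightedStep_perturbedRate_le (r : Kernel X X) [IsJumpKernel r]
    (g : BoundedPerturbation X) {ε θ B : ℝ} (hB : ∀ s x y, |g.toFun s x y| ≤ B) (hε : 0 < ε)
    (hεθ : 4 * ε ≤ θ) (hεB : ε * B ≤ 1) {f h : ℝ × X → ℝ≥0∞} (hf : Measurable f)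
    (hh : Measurable h) (hfh : ∀ p, f p ≤ h p ^ (1 / 2 : ℝ)) (p : ℝ × X) :
    weightedStep (perturbedRate r g ε) (fun _ _ => 1) f p ≤
      weightedStep (unperturbedRate r) (expWeight r g.toFun θ) h p ^ (1 / 2 : ℝ) := by
  obtain ⟨s, x⟩ := p
  have : IsFiniteMeasure (r x) := ⟨IsJumpKernel.mass_lt_top x⟩
  let c0 : ℝ → ℝ := fun u => cumulatedRate (unperturbedRate r) s u x
  let c1 : ℝ → ℝ := fun u => cumulatedRate (perturbedRate r g ε) s u x
  let c2 : ℝ → ℝ := fun u => cumulatedRate (perturbedRate r g (2 * ε)) s u x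
  have hsec : Measurable fun u : ℝ => ((s, x), u) := by fun_prop
  have m0 : Measurable c0 := (measurable_cumulatedRate _).comp hsec
  have m2 : Measurable c2 := (measurable_cumulatedRate _).comp hsec
  have hg : Measurable fun z : ℝ × X => g.toFun z.1 x z.2 :=
    g.measurable.comp (by fun_prop : Measurable fun z : ℝ × X => (z.1, x, z.2))
  have hw : Measurable (expWeight r g.toFun θ (s, x)) :=
    (measurable_expWeight r g θ).comp measurable_prodMk_left
  -- `P²` is the step density for the parameter `2ε`; `Q` is the unperturbed step density times the
  -- weight and `h`. The product `P Q^{1/2}` dominates the perturbed step density times `f`.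
  let P : ℝ × X → ℝ≥0∞ := fun z => ENNReal.ofReal (Real.exp (ε * g.toFun z.1 x z.2 - c2 z.1 / 2))
  let Q : ℝ × X → ℝ≥0∞ := fun z =>
    ENNReal.ofReal (Real.exp (-c0 z.1)) * (expWeight r g.toFun θ (s, x) z * h z)
  have hP : Measurable P := (Real.measurable_exp.comp
    ((hg.const_mul ε).sub ((m2.comp measurable_fst).div_const 2))).ennreal_ofReal
  have hQ : Measurable Q := (Real.measurable_exp.comp
    (m0.comp measurable_fst).neg).ennreal_ofReal.mul (hw.mul hh)
  have hpt : ∀ u y, ENNReal.ofReal (Real.exp (-c1 u)) *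
      (ENNReal.ofReal (Real.exp (ε * g.toFun u x y)) * f (u, y)) ≤
      P (u, y) * Q (u, y) ^ (1 / 2 : ℝ) := by
    intro u y
    have hwt : ENNReal.ofReal (Real.exp (c2 u + c0 u - 2 * c1 u)) ≤ _ :=
      ofReal_exp_le_expWeight r g hB hε hεθ hεB s u x y
    calc ENNReal.ofReal (Real.exp (-c1 u)) *
          (ENNReal.ofReal (Real.exp (ε * g.toFun u x y)) * f (u, y))
        = P (u, y) * ((ENNReal.ofReal (Real.exp (-c0 u)) *
            ENNReal.ofReal (Real.exp (c2 u + c0 u - 2 * c1 u))) ^ (1 / 2 : ℝ) * f (u, y)) := by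
          rw [← mul_assoc, ← mul_assoc]
          congr 1
          rw [← ENNReal.ofReal_mul (Real.exp_pos _).le, ← ENNReal.ofReal_mul (Real.exp_pos _).le,
            ← Real.exp_add, ← Real.exp_add, ENNReal.ofReal_rpow_of_pos (Real.exp_pos _),
            ← Real.exp_mul, ← ENNReal.ofReal_mul (Real.exp_pos _).le, ← Real.exp_add]
          congr 2
          -- The exponents satisfy `ε g - c1 = (ε g - c2 / 2) + (-c0 + (c2 + c0 - 2 c1)) / 2`.
          ring
      _ ≤ P (u, y) * ((ENNReal.ofReal (Real.exp (-c0 u)) *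
            expWeight r g.toFun θ (s, x) (u, y)) ^ (1 / 2 : ℝ) * h (u, y) ^ (1 / 2 : ℝ)) := by
          gcongr
          exact hfh _
      _ = P (u, y) * Q (u, y) ^ (1 / 2 : ℝ) := by
          rw [← ENNReal.mul_rpow_of_nonneg _ _ (by norm_num), mul_assoc]
  have hP2 : ∀ u y, P (u, y) ^ (2 : ℝ) = ENNReal.ofReal (Real.exp (-c2 u)) *
      (ENNReal.ofReal (Real.exp (2 * ε * g.toFun u x y)) * 1) := by
    intro u y
    rw [ENNReal.ofReal_rpow_of_pos (Real.exp_pos _), ← Real.exp_mul, mul_one,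
      ← ENNReal.ofReal_mul (Real.exp_pos _).le, ← Real.exp_add]
    congr 2
    ring
  let μ : Measure (ℝ × X) := (volume.restrict (Set.Ioi s)).prod (r x)
  -- The step kernel for the parameter `2ε` is Markov, so its density has mass one.
  have hPI : ∫⁻ z, P z ^ (2 : ℝ) ∂μ = 1 := by
    rw [lintegral_prod _ (hP.pow_const _).aemeasurable]
    have h1 : ∫⁻ _, 1 ∂(stepKernel (perturbedRate r g (2 * ε)) (s, x)) = 1 := by simp
    rw [lintegral_stepKernel _ s x measurable_const] at h1
    rw [← h1]
    refine lintegral_congr fun u => ?_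
    rw [lintegral_perturbedRate r g _ u x measurable_const,
      ← lintegral_const_mul' _ _ ENNReal.ofReal_ne_top]
    exact lintegral_congr fun y => hP2 u y
  have hQI : ∫⁻ z, Q z ∂μ = weightedStep (unperturbedRate r) (expWeight r g.toFun θ) h (s, x) := by
    rw [lintegral_prod _ hQ.aemeasurable, weightedStep, lintegral_stepKernel _ s x
      (f := fun z => expWeight r g.toFun θ (s, x) z * h z) (hw.mul hh)]
    refine lintegral_congr fun u => ?_
    rw [unperturbedRate, Kernel.prodMkLeft_apply, ← lintegral_const_mul' _ _ ENNReal.ofReal_ne_top]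
    rfl
  have hCS := lintegral_mul_rpow_half_le μ hP hQ
  rw [hPI, hQI, ENNReal.one_rpow, one_mul] at hCS
  refine le_trans ?_ hCS
  have hPQ : Measurable fun z => P z * Q z ^ (1 / 2 : ℝ) := hP.mul (hQ.pow_const _)
  rw [lintegral_prod _ hPQ.aemeasurable, weightedStep]
  simp_rw [one_mul]
  rw [lintegral_stepKernel _ s x hf]
  refine lintegral_mono fun u => ?_
  rw [lintegral_perturbedRate r g ε u x (f := fun y => f (u, y))
      (hf.comp measurable_prodMk_left),
    ← lintegral_const_mul' _ _ ENNReal.ofReal_ne_top]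
  exact lintegral_mono fun y => hpt u y

/-- The relation `f ≤ h^{1/2}` is preserved when each side takes its own step, so the induction runs
over all such pairs and no constant accumulates. -/
theorem iterate_weightedStep_perturbedRate_le (r : Kernel X X) [IsJumpKernel r]
    (g : BoundedPerturbation X) {ε θ B : ℝ} (hB : ∀ s x y, |g.toFun s x y| ≤ B) (hε : 0 < ε)
    (hεθ : 4 * ε ≤ θ) (hεB : ε * B ≤ 1) {f h : ℝ × X → ℝ≥0∞} (hf : Measurable f)
    (hh : Measurable h) (hfh : ∀ p, f p ≤ h p ^ (1 / 2 : ℝ)) (n : ℕ) (p : ℝ × X) :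
    (weightedStep (perturbedRate r g ε) (fun _ _ => 1))^[n] f p ≤
      (weightedStep (unperturbedRate r) (expWeight r g.toFun θ))^[n] h p ^ (1 / 2 : ℝ) := by
  induction n generalizing f h with
  | zero => exact hfh p
  | succ n ih =>
    exact ih (measurable_weightedStep _ measurable_const hf)
      (measurable_weightedStep _ (measurable_expWeight r g θ) hh)
      (weightedStep_perturbedRate_le r g hB hε hεθ hεB hf hh hfh)

/-! ### Weights along a path and the limit of many jumps -/

theorem stateAt_eq_some {Y : Type*} {ω : ℕ → ℝ × Y} (hω : ∀ n, (ω n).1 < (ω (n + 1)).1) {k : ℕ} {s : ℝ}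
    (h1 : (ω k).1 ≤ s) (h2 : s < (ω (k + 1)).1) : stateAt ω s = some (ω k).2 := by
  have hmono : StrictMono fun n => (ω n).1 := strictMono_nat_of_lt_succ hω
  have hex : ∃ n, s < (ω (n + 1)).1 := ⟨k, h2⟩
  classical
  have hk : Nat.find hex = k := by
    rw [Nat.find_eq_iff]
    exact ⟨h2, fun j hj => not_lt.2 ((hmono.monotone (Nat.succ_le_of_lt hj)).trans h1)⟩
  rw [stateAt, dif_pos hex]
  convert! congrArg (fun j => some (ω j).2) hk

/-- Between consecutive jumps, the exponential weights collect the contraction along the path. -/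
theorem prod_expWeight_eq (r : Kernel X X) (α : ℝ → X → X → ℝ) (θ : ℝ) {ω : ℕ → ℝ × X}
    (hω : ∀ n, (ω n).1 < (ω (n + 1)).1) (n : ℕ) :
    ∏ k ∈ Finset.range n, expWeight r α θ (ω k) (ω (k + 1)) =
      EReal.exp ((ENNReal.ofReal θ *
        ∫⁻ s in Set.Ioc (ω 0).1 (ω n).1, absContraction r α s (stateAt ω s) : ℝ≥0∞) : EReal) := by
  have hmono : StrictMono fun n => (ω n).1 := strictMono_nat_of_lt_succ hω
  induction n with
  | zero => simp
  | succ n ih =>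
    have hu : Set.Ioc (ω 0).1 (ω n).1 ∪ Set.Ioc (ω n).1 (ω (n + 1)).1 =
        Set.Ioc (ω 0).1 (ω (n + 1)).1 :=
      Set.Ioc_union_Ioc_eq_Ioc (hmono.monotone n.zero_le) (hω n).le
    have hd : Disjoint (Set.Ioc (ω 0).1 (ω n).1) (Set.Ioc (ω n).1 (ω (n + 1)).1) :=
      Set.Ioc_disjoint_Ioc_of_le le_rfl
    have hs : ∫⁻ s in Set.Ioc (ω n).1 (ω (n + 1)).1, absContraction r α s (some (ω n).2) =
        ∫⁻ s in Set.Ioc (ω n).1 (ω (n + 1)).1, absContraction r α s (stateAt ω s) := by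
      -- The state equals `Y_n` on the half-open interval closed at `T_n`; changing endpoints costs
      -- only a null set.
      rw [← Measure.restrict_congr_set Ico_ae_eq_Ioc]
      exact setLIntegral_congr_fun measurableSet_Ico fun s hs => by
        rw [stateAt_eq_some hω hs.1 hs.2]
    rw [Finset.prod_range_succ, ih, ← hu, lintegral_union measurableSet_Ioc hd, mul_add,
      EReal.coe_ennreal_add, EReal.exp_add, expWeight, hs]

/-- Under non-explosion and the exponential moments condition, the weighted probability of having
at least `n` jumps in `[0, t]` vanishes as `n → ∞`. -/
theorem tendsto_lintegral_prod_expWeight (r : Kernel X X) [IsJumpKernel r] (ν : Measure X)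
    [IsProbabilityMeasure ν]
    (hne : ∀ᵐ ω ∂(jumpLaw (unperturbedRate r) ν), explosionTime ω = ∞)
    (g : BoundedPerturbation X) {θ t : ℝ} (ht : 0 ≤ t)
    (hθ : ∫⁻ ω, EReal.exp ((ENNReal.ofReal θ *
      ∫⁻ s in Set.Icc 0 t, absContraction r g.toFun s (stateAt ω s) : ℝ≥0∞) : EReal)
      ∂(jumpLaw (unperturbedRate r) ν) < ∞) :
    Filter.Tendsto (fun n : ℕ => ∫⁻ ω,
      (∏ k ∈ Finset.range n, expWeight r g.toFun θ (ω k) (ω (k + 1))) *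
        {p : ℝ × X | p.1 ≤ t}.indicator 1 (ω n) ∂(jumpLaw (unperturbedRate r) ν))
      Filter.atTop (nhds 0) := by
  have hS : MeasurableSet {p : ℝ × X | p.1 ≤ t} := measurableSet_le measurable_fst measurable_const
  have hm : ∀ n : ℕ, Measurable fun ω : ℕ → ℝ × X =>
      (∏ k ∈ Finset.range n, expWeight r g.toFun θ (ω k) (ω (k + 1))) *
        {p : ℝ × X | p.1 ≤ t}.indicator (1 : ℝ × X → ℝ≥0∞) (ω n) := fun n =>
    (Finset.measurable_fun_prod _ fun k _ =>
      (measurable_expWeight r g θ).comp (f := fun ω : ℕ → ℝ × X => (ω k, ω (k + 1)))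
        ((measurable_pi_apply _).prodMk (measurable_pi_apply _))).mul
      ((measurable_one.indicator hS).comp (measurable_pi_apply n))
  have h0 := ae_jumpLaw_zero (unperturbedRate r) ν
  have hlt := ae_jumpLaw_lt_succ (unperturbedRate r) ν
  rw [← lintegral_zero (μ := jumpLaw (unperturbedRate r) ν)]
  -- The dominating function is the exponential in `C[ν, t]`: when `T_n ≤ t`, the weights only
  -- collect `|g|_r` up to `T_n`.
  refine tendsto_lintegral_of_dominated_convergence _ hm (fun n => ?_) hθ.ne ?_
  · filter_upwards [h0, hlt] with ω hω0 hω
    by_cases hn : ω n ∈ {p : ℝ × X | p.1 ≤ t}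
    · rw [Set.indicator_of_mem hn, Pi.one_apply, mul_one, prod_expWeight_eq r g.toFun θ hω, hω0]
      refine EReal.exp_monotone (EReal.coe_ennreal_le_coe_ennreal_iff.2 ?_)
      gcongr
      exact fun s hs => ⟨hs.1.le, hs.2.trans hn⟩
    · rw [Set.indicator_of_notMem hn, mul_zero]
      exact zero_le
  · filter_upwards [hlt, hne] with ω hω hex
    have hmono : StrictMono fun n => (ω n).1 := strictMono_nat_of_lt_succ hω
    -- Without explosion some `T_N` exceeds `t`, so the indicator is zero from `N` on.
    have hN : ∃ N, ENNReal.ofReal t < ENNReal.ofReal (ω N).1 := by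
      rw [← lt_iSup_iff]
      exact ENNReal.ofReal_lt_top.trans_eq hex.symm
    obtain ⟨N, hN⟩ := hN
    have hN' : t < (ω N).1 := (ENNReal.ofReal_lt_ofReal_iff_of_nonneg ht).1 hN
    refine tendsto_const_nhds.congr' ?_
    filter_upwards [Filter.eventually_ge_atTop N] with n hn
    have : ω n ∉ {p : ℝ × X | p.1 ≤ t} := not_le.2 (hN'.trans_le (hmono.monotone hn))
    rw [Set.indicator_of_notMem this, mul_zero]

/-- Both iterations start from the indicator of `T_n ≤ t`, which equals its own square root. A last
Cauchy-Schwarz over the probability `ν` moves the square root outside the average over initial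
states. -/
theorem jumpLaw_perturbedRate_le (r : Kernel X X) [IsJumpKernel r] (ν : Measure X)
    [IsProbabilityMeasure ν] (g : BoundedPerturbation X) {ε θ B : ℝ}
    (hB : ∀ s x y, |g.toFun s x y| ≤ B) (hε : 0 < ε) (hεθ : 4 * ε ≤ θ) (hεB : ε * B ≤ 1)
    (t : ℝ) (n : ℕ) :
    jumpLaw (perturbedRate r g ε) ν {ω | (ω n).1 ≤ t} ≤
      (∫⁻ ω, (∏ k ∈ Finset.range n, expWeight r g.toFun θ (ω k) (ω (k + 1))) *
        {p : ℝ × X | p.1 ≤ t}.indicator 1 (ω n) ∂(jumpLaw (unperturbedRate r) ν)) ^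
          (1 / 2 : ℝ) := by
  have hS : MeasurableSet {p : ℝ × X | p.1 ≤ t} := measurableSet_le measurable_fst measurable_const
  let f : ℝ × X → ℝ≥0∞ := {p : ℝ × X | p.1 ≤ t}.indicator 1
  have hf : Measurable f := measurable_one.indicator hS
  have hff : ∀ p, f p ≤ f p ^ (1 / 2 : ℝ) := fun p => by
    by_cases hp : p ∈ {p : ℝ × X | p.1 ≤ t} <;> simp [f, hp]
  have hw := measurable_expWeight r g θ
  have hV : Measurable fun x : X =>
      (weightedStep (unperturbedRate r) (expWeight r g.toFun θ))^[n] f (0, x) := by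
    have : Measurable ((weightedStep (unperturbedRate r) (expWeight r g.toFun θ))^[n] f) := by
      induction n with
      | zero => exact hf
      | succ n ih =>
        rw [Function.iterate_succ_apply']
        exact measurable_weightedStep _ hw ih
    exact this.comp measurable_prodMk_left
  have h1 : jumpLaw (perturbedRate r g ε) ν {ω | (ω n).1 ≤ t} =
      ∫⁻ ω, f (ω n) ∂(jumpLaw (perturbedRate r g ε) ν) := by
    rw [← lintegral_indicator_one (measurableSet_le (by fun_prop) measurable_const)]
    rfl
  have h2 := lintegral_jumpLaw_prod (perturbedRate r g ε) ν (w := fun _ _ => 1)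
    measurable_const n hf
  simp only [Finset.prod_const_one, one_mul] at h2
  rw [h1, h2, lintegral_jumpLaw_prod (unperturbedRate r) ν hw n hf]
  refine (lintegral_mono fun x => iterate_weightedStep_perturbedRate_le r g hB hε hεθ hεB hf hf
    hff n (0, x)).trans ?_
  simpa using lintegral_mul_rpow_half_le ν measurable_one hV

end MarkovJump

/-! ### Conclusion -/

theorem mainTheorem1 {X : Type*} [MeasurableSpace X] [MeasurableSingletonClass X]
    (r : Kernel X X) [MarkovJump.IsJumpKernel r]
    (ν : Measure X) [IsProbabilityMeasure ν]
    (hne : ∀ᵐ ω ∂(MarkovJump.jumpLaw (MarkovJump.unperturbedRate r) ν),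
      MarkovJump.explosionTime ω = ∞)
    (g : MarkovJump.BoundedPerturbation X) (t : ℝ) (ht : 0 ≤ t)
    (hg : MarkovJump.ExpMomentCondition r ν t g.toFun) :
    ∃ ε₀ : ℝ, 0 < ε₀ ∧ ∀ ε : ℝ, 0 < ε → ε ≤ ε₀ →
      ∀ᵐ ω ∂(MarkovJump.jumpLaw (MarkovJump.perturbedRate r g ε) ν),
        ENNReal.ofReal t < MarkovJump.explosionTime ω := by
  obtain ⟨θ, hθ, hfin⟩ := hg
  obtain ⟨B, hB⟩ := g.bounded
  -- The first bound gives `4 ε ≤ θ`, the second `ε B ≤ 1`; adding `1` keeps the denominator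
  -- positive.
  refine ⟨min (θ / 4) (1 / (|B| + 1)), by positivity, fun ε hε hle => ?_⟩
  have hεθ : 4 * ε ≤ θ := by linarith [hle.trans (min_le_left _ _)]
  have hεB : ε * B ≤ 1 := by
    have h1 := hle.trans (min_le_right _ _)
    rw [le_div_iff₀ (by positivity)] at h1
    exact (mul_le_mul_of_nonneg_left ((le_abs_self B).trans (by linarith)) hε.le).trans h1
  have hlim := (MarkovJump.tendsto_lintegral_prod_expWeight r ν hne g ht hfin).ennrpow_const
    (1 / 2 : ℝ)
  rw [ENNReal.zero_rpow_of_pos (by norm_num)] at hlim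
  rw [ae_iff, ← nonpos_iff_eq_zero]
  -- If the explosion time is at most `t`, then `T_n ≤ t` for every `n`, so every term of the
  -- sequence bounds the probability of this event.
  refine ge_of_tendsto' hlim fun n => le_trans (measure_mono fun ω hω => ?_)
    (MarkovJump.jumpLaw_perturbedRate_le r ν g hB hε hεθ hεB t n)
  exact (ENNReal.ofReal_le_ofReal_iff ht).1
    ((le_iSup (fun n => ENNReal.ofReal (ω n).1) n).trans (not_lt.1 hω))
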